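/- Let $G$ be a countable group with identity $e$, and let $(S_n)_{n\ge 0}$ be a random walk on $G$ with $S_0=e$ almost surely, that is, the increments $\xi_n=S_{n-1}^{-1}S_n$, $n\ge 1$, are independent and identically distributed $G$-valued random variables. Suppose that the walk is transient: almost surely $S_n=e$ for only finitely many $n$. Let $$\gamma=P(S_n\ne e\text{ for all }n\ge 1)$$ be its escape probability, and for $n\ge 0$ and $x\in G$ let $\ell(n,x)=\sum_{i=0}^{n}\mathbb{1}_{\{S_i=x\}}$ be the local time of $x$ up to time $n$. Let $f:\{0,1,2,\dots\}\to\mathbb{R}$ satisfy $f(0)=0$ and $$\sum_{j=1}^{\infty}|f(j)|(1-\gamma)^j<\infty,$$ and for $n\ge 1$ put $G_n(f)=\sum_{x\in G}f(\ell(n-1,x))$. Then $\gamma>0$, the series $\sum_{j=1}^{\infty}f(j)(1-\gamma)^{j-1}$ (with $0^0=1$) converges absolutely, every $G_n(f)$ with $n\ge 1$ is integrable, and as $n\to\infty$ $$\frac{1}{n}G_n(f)\to\gamma^2\sum_{j=1}^{\infty}f(j)(1-\gamma)^{j-1}$$ almost surely and in $L^1$. -/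

import Mathlib

open MeasureTheory ProbabilityTheory Filter Topology

/-- `S = (S_n)_{n ≥ 0}` is a (right) random walk on the group `G` started at the identity, under
the probability measure `μ`: `S_0 = e` almost surely, and the increments `S_n⁻¹ S_{n+1}`, `n ≥ 0`,
are independent and identically distributed. -/
structure IsRandomWalk {Ω G : Type*} [MeasurableSpace Ω] [Group G] [MeasurableSpace G]
    (S : ℕ → Ω → G) (μ : Measure Ω) : Prop where
  measurable : ∀ n, Measurable (S n)
  start : ∀ᵐ ω ∂μ, S 0 ω = 1
  indep : iIndepFun (fun n ω => (S n ω)⁻¹ * S (n + 1) ω) μ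
  identDistrib : ∀ n, IdentDistrib (fun ω => (S n ω)⁻¹ * S (n + 1) ω)
    (fun ω => (S 0 ω)⁻¹ * S 1 ω) μ μ

/-- The walk `S` is transient: almost surely, it visits the identity only finitely often. -/
def IsTransient {Ω G : Type*} [MeasurableSpace Ω] [Group G]
    (S : ℕ → Ω → G) (μ : Measure Ω) : Prop :=
  ∀ᵐ ω ∂μ, {n : ℕ | S n ω = 1}.Finite

/-- The escape probability `γ = P(S_n ≠ e for all n ≥ 1)`. -/
noncomputable def escapeProb {Ω G : Type*} [MeasurableSpace Ω] [Group G]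
    (S : ℕ → Ω → G) (μ : Measure Ω) : ℝ :=
  μ.real {ω | ∀ n : ℕ, 1 ≤ n → S n ω ≠ 1}

open Classical in
/-- The local time `ℓ(n, x) = #{0 ≤ i ≤ n : S_i = x}`. -/
noncomputable def localTime {Ω G : Type*} (S : ℕ → Ω → G) (n : ℕ) (x : G) (ω : Ω) : ℕ :=
  ((Finset.range (n + 1)).filter (fun i => S i ω = x)).card

/-- `G_n(f) = ∑_{x ∈ G} f(ℓ(n - 1, x))` for `n ≥ 1`. When `f 0 = 0`, only the finitely many `x`
visited before time `n` contribute. -/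
noncomputable def localTimeSum {Ω G : Type*} (S : ℕ → Ω → G) (f : ℕ → ℝ) (n : ℕ) (ω : Ω) : ℝ :=
  ∑' x : G, f (localTime S (n - 1) x ω)

/-! Put `g v = f v - f (v - 1)`. If `x` is visited `k` times before time `n`, then at its successive
visits the number of visits still to be counted, the present one included, is `k, k - 1, …, 1`, so
`f k` telescopes into values of `g`. Hence `G_n(f)` is the sum over `i < n` of `g` at the number of
visits to `e`, before time `n - i`, of the walk restarted at time `i`
(`localTimeSum_eq_sum_visits`).

By transience the restarted count eventually equals its total `V`, so this is nearly a Birkhoff sum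
of `g(V)` for the shift on i.i.d. increments, which is ergodic. The truncations are dominated by `H
= ∑_{k < V} |g (k + 1)|`, and `Ergodic.ae_tendsto_sum_approx_div` and
`Ergodic.tendsto_eLpNorm_sum_approx_div` give both modes of convergence to `E g(V)`.

With `q = 1 - γ`, the strong Markov property gives `P(V ≥ k + 1) = q ^ k` (`infinitePi_visitsGE`).
Thus `q < 1`, `H` is integrable, and two summations by parts turn `E g(V) = ∑ (g (k + 1) - g k) q ^
k` into `γ² ∑ f (k + 1) q ^ k`. -/

/-! ### Birkhoff's ergodic theorem -/

section ErgodicTheorem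

/-- The running maximum `max (0, S_1, …, S_n)` of the Birkhoff sums of `φ`. -/
noncomputable def birkhoffMax {α : Type*} (T : α → α) (φ : α → ℝ) : ℕ → α → ℝ
  | 0, _ => 0
  | n + 1, x => max 0 (φ x + birkhoffMax T φ n (T x))

variable {α : Type*} {T : α → α} {φ : α → ℝ}

lemma birkhoffMax_nonneg (n : ℕ) (x : α) : 0 ≤ birkhoffMax T φ n x := by
  cases n <;> simp [birkhoffMax]

lemma birkhoffMax_le_succ (n : ℕ) (x : α) :
    birkhoffMax T φ n x ≤ birkhoffMax T φ (n + 1) x := by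
  induction n generalizing x with
  | zero => simp [birkhoffMax]
  | succ n ih =>
    rw [birkhoffMax, birkhoffMax]
    gcongr
    exact ih _

lemma birkhoffMax_mono (x : α) : Monotone fun n => birkhoffMax T φ n x :=
  monotone_nat_of_le_succ fun n => birkhoffMax_le_succ n x

lemma birkhoffSum_le_birkhoffMax (n : ℕ) (x : α) :
    birkhoffSum T φ n x ≤ birkhoffMax T φ n x := by
  induction n generalizing x with
  | zero => simp [birkhoffMax]
  | succ n ih =>
    rw [birkhoffSum_succ', birkhoffMax]
    exact le_max_of_le_right (by gcongr; exact ih _)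

variable [MeasurableSpace α] {μ : Measure α}

lemma measurable_birkhoffMax (hT : Measurable T) (hφ : Measurable φ) (n : ℕ) :
    Measurable (birkhoffMax T φ n) := by
  induction n with
  | zero => exact measurable_const
  | succ n ih => exact measurable_const.max (hφ.add (ih.comp hT))

lemma integrable_birkhoffMax (hT : MeasurePreserving T μ μ) (hφ : Integrable φ μ) (n : ℕ) :
    Integrable (birkhoffMax T φ n) μ := by
  induction n with
  | zero => exact integrable_zero _ _ _
  | succ n ih => exact (integrable_zero _ _ _).sup (hφ.add (hT.integrable_comp_of_integrable ih))

omit [MeasurableSpace α] in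
lemma preimage_bddAbove_birkhoffMax :
    T ⁻¹' {x | BddAbove (Set.range fun n => birkhoffMax T φ n x)} =
      {x | BddAbove (Set.range fun n => birkhoffMax T φ n x)} := by
  ext x
  constructor
  · rintro ⟨C, hC⟩
    refine ⟨max 0 (φ x + C), ?_⟩
    rintro _ ⟨n, rfl⟩
    refine (birkhoffMax_le_succ n x).trans ?_
    rw [birkhoffMax]
    gcongr
    exact hC ⟨n, rfl⟩
  · rintro ⟨C, hC⟩
    refine ⟨C - φ x, ?_⟩
    rintro _ ⟨n, rfl⟩
    have h1 : birkhoffMax T φ (n + 1) x ≤ C := hC ⟨n + 1, rfl⟩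
    have h2 : φ x + birkhoffMax T φ n (T x) ≤ birkhoffMax T φ (n + 1) x := le_max_right _ _
    show birkhoffMax T φ n (T x) ≤ C - φ x
    linarith

/-- If `∫ φ < 0`, the Birkhoff sums of `φ` are almost surely bounded above. -/
lemma Ergodic.ae_bddAbove_birkhoffSum (hT : Ergodic T μ) (hφm : Measurable φ)
    (hφ : Integrable φ μ) (hneg : ∫ x, φ x ∂μ < 0) :
    ∀ᵐ x ∂μ, ∃ C, ∀ n, birkhoffSum T φ n x ≤ C := by
  have hTm := hT.toMeasurePreserving
  set A := {x | BddAbove (Set.range fun n => birkhoffMax T φ n x)} with hA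
  have hAm : MeasurableSet A :=
    measurableSet_bddAbove_range fun n => measurable_birkhoffMax hTm.measurable hφm n
  have hinv : T ⁻¹' A = A := preimage_bddAbove_birkhoffMax
  rcases eventuallyConst_set.1 (hT.toPreErgodic.aeconst_set hAm hinv) with h | h
  · filter_upwards [h] with x ⟨C, hC⟩
    exact ⟨C, fun n => (birkhoffSum_le_birkhoffMax n x).trans (hC ⟨n, rfl⟩)⟩
  · exfalso
    -- The integrand is `max (-birkhoffMax T φ n (T x)) (φ x)`: it is bounded by `|φ x|`, and it
    -- equals `φ x` once the maximum at `T x`, which diverges on the complement of `A`, is large.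
    have hlim : Tendsto (fun n => ∫ x, (birkhoffMax T φ (n + 1) x - birkhoffMax T φ n (T x)) ∂μ)
        atTop (𝓝 (∫ x, φ x ∂μ)) := by
      refine tendsto_integral_of_dominated_convergence (fun x => |φ x|) (fun n => ?_) hφ.abs
        (fun n => ?_) ?_
      · exact ((measurable_birkhoffMax hTm.measurable hφm _).sub
          ((measurable_birkhoffMax hTm.measurable hφm _).comp
            hTm.measurable)).aestronglyMeasurable
      · refine Eventually.of_forall fun x => ?_
        have h0 := birkhoffMax_nonneg (T := T) (φ := φ) n (T x)
        rw [birkhoffMax, Real.norm_eq_abs, abs_le]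
        have := neg_abs_le (φ x)
        have := le_abs_self (φ x)
        have := abs_nonneg (φ x)
        constructor
        · have := le_max_right 0 (φ x + birkhoffMax T φ n (T x))
          linarith
        · have : max 0 (φ x + birkhoffMax T φ n (T x)) ≤ |φ x| + birkhoffMax T φ n (T x) :=
            max_le (by linarith) (by linarith)
          linarith
      · filter_upwards [h] with x hx
        have hx' : T x ∉ A := fun hTx => hx (by rw [← hinv]; exact hTx)
        have hinf : Tendsto (fun n => birkhoffMax T φ n (T x)) atTop atTop :=
          tendsto_atTop_atTop_of_monotone' (birkhoffMax_mono _) hx'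
        refine tendsto_const_nhds.congr' ?_
        filter_upwards [hinf.eventually_ge_atTop (-φ x)] with n hn
        rw [birkhoffMax, max_eq_right (by linarith)]
        ring
    -- By invariance of `μ` the composition with `T` drops out of the integral, leaving the integral
    -- of an increment of a monotone sequence.
    have hge : 0 ≤ ∫ x, φ x ∂μ := by
      refine ge_of_tendsto' hlim fun n => ?_
      have hi := integrable_birkhoffMax hTm hφ
      rw [integral_sub (hi _) (g := fun x => birkhoffMax T φ n (T x))
        (hTm.integrable_comp_of_integrable (hi n)), sub_nonneg]
      have : ∫ x, birkhoffMax T φ n (T x) ∂μ = ∫ x, birkhoffMax T φ n x ∂μ := by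
        conv_rhs => rw [← hTm.map_eq]
        rw [integral_map hTm.aemeasurable
          (measurable_birkhoffMax hTm.measurable hφm n).aestronglyMeasurable]
      rw [this]
      exact integral_mono (hi n) (hi _) fun x => birkhoffMax_le_succ n x
    exact absurd hneg hge.not_gt

/-- After subtracting slightly more than the mean, the Birkhoff sums are bounded above and the bound
disappears on division by `n`. Countably many excesses `1 / (k + 1)` suffice for all `c` at once. -/
lemma Ergodic.ae_eventually_birkhoffSum_div_le [IsProbabilityMeasure μ] (hT : Ergodic T μ)
    (hφm : Measurable φ) (hφ : Integrable φ μ) :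
    ∀ᵐ x ∂μ, ∀ c, ∫ x, φ x ∂μ < c → ∀ᶠ n : ℕ in atTop, birkhoffSum T φ n x / n < c := by
  have key : ∀ k : ℕ, ∀ᵐ x ∂μ, ∃ C, ∀ n : ℕ,
      birkhoffSum T φ n x - n * (∫ x, φ x ∂μ + 1 / (k + 1 : ℝ)) ≤ C := by
    intro k
    have h := hT.ae_bddAbove_birkhoffSum
      (φ := fun x => φ x - (∫ x, φ x ∂μ + 1 / (k + 1 : ℝ))) (hφm.sub measurable_const)
      (hφ.sub (integrable_const _)) (by
        rw [integral_sub hφ (integrable_const _)]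
        simp only [integral_const, probReal_univ, one_smul]
        have : 0 < 1 / (k + 1 : ℝ) := by positivity
        linarith)
    filter_upwards [h] with x ⟨C, hC⟩
    refine ⟨C, fun n => ?_⟩
    have := hC n
    rwa [birkhoffSum, Finset.sum_sub_distrib, Finset.sum_const, Finset.card_range,
      nsmul_eq_mul] at this
  filter_upwards [ae_all_iff.2 key] with x hx c hc
  obtain ⟨k, hk⟩ := exists_nat_one_div_lt (sub_pos.2 hc)
  obtain ⟨C, hC⟩ := hx k
  have hlim : Tendsto (fun n : ℕ => C / n + (∫ x, φ x ∂μ + 1 / (k + 1 : ℝ))) atTop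
      (𝓝 (0 + (∫ x, φ x ∂μ + 1 / (k + 1 : ℝ)))) :=
    (tendsto_const_div_atTop_nhds_zero_nat C).add_const _
  filter_upwards [hlim.eventually_lt_const (show _ < c by linarith), eventually_gt_atTop 0]
    with n hn hn0
  have hn0' : (0 : ℝ) < n := by exact_mod_cast hn0
  refine lt_of_le_of_lt ?_ hn
  rw [div_le_iff₀ hn0', add_mul, div_mul_cancel₀ _ hn0'.ne']
  linarith [hC n]

/-- **Birkhoff's pointwise ergodic theorem**, for an ergodic map. -/
theorem Ergodic.ae_tendsto_birkhoffSum_div [IsProbabilityMeasure μ] (hT : Ergodic T μ)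
    (hφm : Measurable φ) (hφ : Integrable φ μ) :
    ∀ᵐ x ∂μ, Tendsto (fun n : ℕ => birkhoffSum T φ n x / n) atTop (𝓝 (∫ x, φ x ∂μ)) := by
  filter_upwards [hT.ae_eventually_birkhoffSum_div_le hφm hφ,
    hT.ae_eventually_birkhoffSum_div_le hφm.neg hφ.neg] with x h1 h2
  refine tendsto_order.2 ⟨fun c hc => ?_, fun c hc => h1 c hc⟩
  filter_upwards [h2 (-c) (by simp only [Pi.neg_apply, integral_neg]; linarith)] with n hn
  have : birkhoffSum T (-φ) n x = -birkhoffSum T φ n x := by simp [birkhoffSum]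
  rw [this, neg_div] at hn
  linarith

/-! ### Birkhoff averages with truncated terms -/

/-- A Birkhoff average whose `i`-th term uses an approximation of `φ` of order `n - i` has the same
limit, when the approximations are eventually exact and dominated by an integrable function. -/
theorem Ergodic.ae_tendsto_sum_approx_div [IsProbabilityMeasure μ] (hT : Ergodic T μ)
    (hφm : Measurable φ) {a : ℕ → α → ℝ} (ham : ∀ n, Measurable (a n)) {H : α → ℝ}
    (hHm : Measurable H) (hH : Integrable H μ) (hφH : ∀ᵐ x ∂μ, |φ x| ≤ H x)
    (haH : ∀ᵐ x ∂μ, ∀ n, |a n x| ≤ H x)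
    (hconv : ∀ᵐ x ∂μ, ∃ N, ∀ n, N ≤ n → a n x = φ x) :
    ∀ᵐ x ∂μ, Tendsto (fun n : ℕ => (∑ i ∈ Finset.range n, a (n - i) (T^[i] x)) / n) atTop
      (𝓝 (∫ x, φ x ∂μ)) := by
  classical
  have hφ : Integrable φ μ := hH.mono' hφm.aestronglyMeasurable hφH
  -- `E M` is where the approximation is not yet exact from order `M` on. These sets decrease to a
  -- null set, so the error bound `D M` has integral tending to `0`.
  set E : ℕ → Set α := fun M => {x | ∃ n, M ≤ n ∧ a n x ≠ φ x} with hE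
  have hEm : ∀ M, MeasurableSet (E M) := fun M => by
    have : E M = ⋃ n, ⋃ (_ : M ≤ n), {x | a n x = φ x}ᶜ := by ext; simp [hE]
    rw [this]
    exact .iUnion fun n => .iUnion fun _ => (measurableSet_eq_fun (ham n) hφm).compl
  set D : ℕ → α → ℝ := fun M => (E M).indicator (fun x => 2 * H x) with hD
  have hDm : ∀ M, Measurable (D M) := fun M => (hHm.const_mul 2).indicator (hEm M)
  have hDi : ∀ M, Integrable (D M) μ := fun M => (hH.const_mul 2).indicator (hEm M)
  have hDlim : Tendsto (fun M => ∫ x, D M x ∂μ) atTop (𝓝 0) := by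
    rw [← integral_zero α ℝ (μ := μ)]
    refine tendsto_integral_of_dominated_convergence (fun x => |2 * H x|)
      (fun M => (hDm M).aestronglyMeasurable) (hH.const_mul 2).abs
      (fun M => .of_forall fun x => ?_) ?_
    · simp only [hD, Set.indicator]
      split_ifs <;> simp
    · filter_upwards [hconv] with x ⟨N, hN⟩
      refine tendsto_const_nhds.congr' ?_
      filter_upwards [eventually_ge_atTop N] with M hM
      refine (Set.indicator_of_notMem ?_ _).symm
      rintro ⟨n, hn, hne⟩
      exact hne (hN n (hM.trans hn))
  have hiter : ∀ {p : α → Prop}, (∀ᵐ x ∂μ, p x) → ∀ᵐ x ∂μ, ∀ i : ℕ, p (T^[i] x) := fun h =>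
    ae_all_iff.2 fun i => (hT.toMeasurePreserving.iterate i).quasiMeasurePreserving.ae h
  filter_upwards [hT.ae_tendsto_birkhoffSum_div hφm hφ, hT.ae_tendsto_birkhoffSum_div hHm hH,
    ae_all_iff.2 fun M => hT.ae_tendsto_birkhoffSum_div (hDm M) (hDi M), hiter hφH, hiter haH]
    with x hxφ hxH hxD hbφ hba
  suffices h0 : Tendsto (fun n : ℕ => (∑ i ∈ Finset.range n, a (n - i) (T^[i] x)) / n -
      birkhoffSum T φ n x / n) atTop (𝓝 0) by simpa using h0.add hxφ
  have hH0 : ∀ i : ℕ, 0 ≤ H (T^[i] x) := fun i => (abs_nonneg _).trans (hbφ i)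
  have hD0 : ∀ M i, 0 ≤ D M (T^[i] x) := fun M i =>
    Set.indicator_apply_nonneg fun _ => by have := hH0 i; positivity
  -- The averages at `n` and `n + M` have the same limit, so the last `M` terms contribute nothing.
  have htail : ∀ M : ℕ, Tendsto (fun n : ℕ =>
      (birkhoffSum T H (n + M) x - birkhoffSum T H n x) / (n + M : ℕ)) atTop (𝓝 0) := by
    intro M
    have h1 := hxH.comp (tendsto_add_atTop_nat M)
    have h2 : Tendsto (fun n : ℕ => (n : ℝ) / (n + M : ℕ)) atTop (𝓝 1) := by
      have := tendsto_natCast_div_add_atTop (M : ℝ)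
      simpa using this
    have h3 := h1.sub (hxH.mul h2)
    simp only [mul_one, sub_self] at h3
    refine h3.congr' ?_
    filter_upwards [eventually_gt_atTop 0] with n hn
    have hn' : (n : ℝ) ≠ 0 := by exact_mod_cast hn.ne'
    simp only [Function.comp]
    field_simp
  -- For `i < n` the order `n + M - i` is at least `M`, so the error is charged to `D M`; the last
  -- `M` terms are charged to `2 * H`.
  have hmain : ∀ M n : ℕ, |(∑ i ∈ Finset.range (n + M), a (n + M - i) (T^[i] x)) / (n + M : ℕ) -
      birkhoffSum T φ (n + M) x / (n + M : ℕ)| ≤ birkhoffSum T (D M) (n + M) x / (n + M : ℕ) +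
        2 * ((birkhoffSum T H (n + M) x - birkhoffSum T H n x) / (n + M : ℕ)) := by
    intro M n
    rw [← sub_div, abs_div, Nat.abs_cast, ← mul_div_assoc, ← add_div]
    gcongr
    have hdiff : ∀ i : ℕ, ∀ k : ℕ, |a k (T^[i] x) - φ (T^[i] x)| ≤ 2 * H (T^[i] x) := by
      intro i k
      have h1 := hba i k
      have h2 := hbφ i
      have := abs_sub (a k (T^[i] x)) (φ (T^[i] x))
      linarith
    rw [birkhoffSum, ← Finset.sum_sub_distrib]
    refine (Finset.abs_sum_le_sum_abs _ _).trans ?_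
    rw [Finset.sum_range_add]
    refine add_le_add ?_ ?_
    · rw [birkhoffSum, Finset.sum_range_add]
      refine le_add_of_le_of_nonneg (Finset.sum_le_sum fun i hi => ?_)
        (Finset.sum_nonneg fun i _ => hD0 _ _)
      have hi := Finset.mem_range.1 hi
      by_cases hmem : T^[i] x ∈ E M
      · simp only [hD, Set.indicator_of_mem hmem]
        exact hdiff _ _
      · have : a (n + M - i) (T^[i] x) = φ (T^[i] x) := by
          by_contra hne
          exact hmem ⟨_, by omega, hne⟩
        rw [this, sub_self, abs_zero]
        exact hD0 _ _
    · rw [birkhoffSum, Finset.sum_range_add, birkhoffSum, add_sub_cancel_left, Finset.mul_sum]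
      exact Finset.sum_le_sum fun i _ => hdiff _ _
  rw [Metric.tendsto_atTop']
  intro ε hε
  obtain ⟨M, hM⟩ := (hDlim.eventually_lt_const hε).exists
  have hb := ((hxD M).comp (tendsto_add_atTop_nat M)).add ((htail M).const_mul 2)
  rw [mul_zero, add_zero] at hb
  obtain ⟨N, hN⟩ := eventually_atTop.1 (hb.eventually_lt_const hM)
  refine ⟨N + M, fun n hn => ?_⟩
  obtain ⟨k, rfl⟩ : ∃ k, n = k + M := ⟨n - M, by omega⟩
  rw [Real.dist_eq, sub_zero]
  exact (hmain M k).trans_lt (hN k (by omega))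

end ErgodicTheorem

/-! ### Convergence in `L¹` -/

/-- A dominated convergence theorem with varying dominating functions of constant integral. -/
lemma tendsto_lintegral_zero_of_le {α : Type*} [MeasurableSpace α] {μ : Measure α}
    {u w : ℕ → α → ENNReal} {v : α → ENNReal} (hu : ∀ n, AEMeasurable (u n) μ)
    (hw : ∀ n, AEMeasurable (w n) μ) (hle : ∀ n, u n ≤ᵐ[μ] w n)
    (hu0 : ∀ᵐ x ∂μ, Tendsto (fun n => u n x) atTop (𝓝 0))
    (hwv : ∀ᵐ x ∂μ, Tendsto (fun n => w n x) atTop (𝓝 (v x)))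
    (hint : ∀ n, ∫⁻ x, w n x ∂μ = ∫⁻ x, v x ∂μ) (hfin : ∫⁻ x, v x ∂μ ≠ ⊤) :
    Tendsto (fun n => ∫⁻ x, u n x ∂μ) atTop (𝓝 0) := by
  have hfu : ∀ n, ∫⁻ x, u n x ∂μ ≠ ⊤ := fun n =>
    ne_top_of_le_ne_top (hint n ▸ hfin) (lintegral_mono_ae (hle n))
  -- Fatou's lemma is applied to `w n - u n`, which tends to `v`.
  have h1 : ∫⁻ x, v x ∂μ ≤ liminf (fun n => ∫⁻ x, (w n x - u n x) ∂μ) atTop := by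
    refine le_trans (le_of_eq (lintegral_congr_ae ?_))
      (lintegral_liminf_le' fun n => (hw n).sub (hu n))
    filter_upwards [hu0, hwv] with x h0 hv
    have := ENNReal.Tendsto.sub hv h0 (Or.inr ENNReal.zero_ne_top)
    rw [tsub_zero] at this
    exact this.liminf_eq.symm
  have h2 : ∀ n, ∫⁻ x, (w n x - u n x) ∂μ = ∫⁻ x, v x ∂μ - ∫⁻ x, u n x ∂μ := fun n => by
    rw [lintegral_sub' (hu n) (hfu n) (hle n), hint n]
  simp only [h2] at h1
  have hle' : ∀ n, ∫⁻ x, u n x ∂μ ≤ ∫⁻ x, v x ∂μ := fun n =>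
    (lintegral_mono_ae (hle n)).trans (hint n).le
  rw [ENNReal.tendsto_atTop_zero]
  intro ε hε
  by_cases hv0 : ∫⁻ x, v x ∂μ = 0
  · exact ⟨0, fun n _ => ((hle' n).trans hv0.le).trans zero_le⟩
  have hlt : ∫⁻ x, v x ∂μ - ε < liminf (fun n => ∫⁻ x, v x ∂μ - ∫⁻ x, u n x ∂μ) atTop :=
    (ENNReal.sub_lt_self hfin hv0 hε.ne').trans_le h1
  obtain ⟨N, hN⟩ := eventually_atTop.1 (eventually_lt_of_lt_liminf hlt)
  refine ⟨N, fun n hn => ?_⟩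
  by_contra! hc
  exact absurd (hN n hn) (not_lt.2 (tsub_le_tsub_left hc.le _))

section ErgodicTheorem

variable {α : Type*} [MeasurableSpace α] {μ : Measure α} {T : α → α}

lemma integrable_sum_approx [IsProbabilityMeasure μ] (hT : MeasurePreserving T μ μ)
    {a : ℕ → α → ℝ} (ham : ∀ n, Measurable (a n)) {H : α → ℝ} (hH : Integrable H μ)
    (haH : ∀ᵐ x ∂μ, ∀ n, |a n x| ≤ H x) (n : ℕ) :
    Integrable (fun x => ∑ i ∈ Finset.range n, a (n - i) (T^[i] x)) μ :=
  integrable_finsetSum _ fun i _ => (hT.iterate i).integrable_comp_of_integrable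
    (hH.mono' (ham _).aestronglyMeasurable (haH.mono fun _ h => h _))

/-- The `L¹` version of `Ergodic.ae_tendsto_sum_approx_div`. -/
theorem Ergodic.tendsto_eLpNorm_sum_approx_div [IsProbabilityMeasure μ] (hT : Ergodic T μ)
    {φ : α → ℝ} (hφm : Measurable φ) {a : ℕ → α → ℝ} (ham : ∀ n, Measurable (a n)) {H : α → ℝ}
    (hHm : Measurable H) (hH : Integrable H μ) (hφH : ∀ᵐ x ∂μ, |φ x| ≤ H x)
    (haH : ∀ᵐ x ∂μ, ∀ n, |a n x| ≤ H x)
    (hconv : ∀ᵐ x ∂μ, ∃ N, ∀ n, N ≤ n → a n x = φ x) :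
    Tendsto (fun n : ℕ => eLpNorm (fun x => (∑ i ∈ Finset.range n, a (n - i) (T^[i] x)) / n -
      ∫ x, φ x ∂μ) 1 μ) atTop (𝓝 0) := by
  have hTm := hT.toMeasurePreserving
  set c := ∫ x, φ x ∂μ with hc
  have hTi : ∀ i, Measurable T^[i] := fun i => hTm.measurable.iterate i
  have hbm : ∀ n, Measurable (birkhoffSum T H n) := fun n =>
    Finset.measurable_sum _ fun i _ => hHm.comp (hTi i)
  have hbi : ∀ n, Integrable (birkhoffSum T H n) μ := fun n =>
    integrable_finsetSum _ fun i _ => (hTm.iterate i).integrable_comp_of_integrable hH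
  have hbint : ∀ n, ∫ x, birkhoffSum T H n x ∂μ = n * ∫ x, H x ∂μ := fun n => by
    simp only [birkhoffSum]
    rw [integral_finsetSum (f := fun i x => H (T^[i] x)) _ fun i _ =>
      (hTm.iterate i).integrable_comp_of_integrable hH]
    have : ∀ i : ℕ, ∫ x, H (T^[i] x) ∂μ = ∫ x, H x ∂μ := fun i => by
      conv_rhs => rw [← (hTm.iterate i).map_eq]
      rw [integral_map (hTi i).aemeasurable hHm.aestronglyMeasurable]
    simp [this]
  have hall : ∀ᵐ x ∂μ, ∀ i k : ℕ, |a k (T^[i] x)| ≤ H (T^[i] x) :=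
    ae_all_iff.2 fun i => (hTm.iterate i).quasiMeasurePreserving.ae haH
  simp only [eLpNorm_one_eq_lintegral_enorm]
  -- At `n = 0` division by zero gives `0`, and the dominating function would not have the constant
  -- integral required below.
  rw [← tendsto_add_atTop_iff_nat 1]
  refine tendsto_lintegral_zero_of_le
    (w := fun n x => ENNReal.ofReal (birkhoffSum T H (n + 1) x / (n + 1 : ℕ) + |c|))
    (v := fun _ => ENNReal.ofReal (∫ x, H x ∂μ + |c|)) (fun n => ?_) (fun n => ?_) (fun n => ?_)
    ?_ ?_ (fun n => ?_) ?_
  · exact (((Finset.measurable_sum _ fun i _ => (ham _).comp (hTi i)).div_const _).sub_const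
      _).enorm.aemeasurable
  · exact (((hbm _).div_const _).add_const _).ennreal_ofReal.aemeasurable
  · filter_upwards [hall] with x hx
    rw [Real.enorm_eq_ofReal_abs]
    refine ENNReal.ofReal_le_ofReal ((abs_sub _ _).trans ?_)
    rw [abs_div, Nat.abs_cast]
    gcongr
    exact (Finset.abs_sum_le_sum_abs _ _).trans (Finset.sum_le_sum fun i _ => hx _ _)
  · filter_upwards [hT.ae_tendsto_sum_approx_div hφm ham hHm hH hφH haH hconv] with x hx
    have := ((hx.comp (tendsto_add_atTop_nat 1)).sub_const c).enorm
    rwa [← hc, sub_self, enorm_zero] at this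
  · filter_upwards [hT.ae_tendsto_birkhoffSum_div hHm hH] with x hx
    exact ENNReal.tendsto_ofReal ((hx.comp (tendsto_add_atTop_nat 1)).add_const |c|)
  · have hi : Integrable (fun x => birkhoffSum T H (n + 1) x / (n + 1 : ℕ) + |c|) μ :=
      ((hbi _).div_const _).add (integrable_const _)
    rw [← ofReal_integral_eq_lintegral_ofReal hi,
      integral_add ((hbi _).div_const _) (integrable_const _), integral_div, hbint,
      mul_div_cancel_left₀ _ (by positivity)]
    · simp
    · filter_upwards [hall] with x hx
      refine add_nonneg (div_nonneg (Finset.sum_nonneg fun i _ => ?_) (Nat.cast_nonneg _))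
        (abs_nonneg _)
      exact (abs_nonneg _).trans (hx i 0)
  · simp

end ErgodicTheorem

/-! ### Ergodicity of the Bernoulli shift -/

section Shift

/-- The one-sided shift on sequences. -/
def seqShift {α : Type*} (x : ℕ → α) : ℕ → α := fun n => x (n + 1)

lemma seqShift_iterate {α : Type*} (m : ℕ) (x : ℕ → α) (n : ℕ) :
    seqShift^[m] x n = x (n + m) := by
  induction m generalizing x with
  | zero => rfl
  | succ m ih => rw [Function.iterate_succ_apply, ih, seqShift, add_assoc]

variable {α : Type*} [MeasurableSpace α] (ρ : Measure α) [IsProbabilityMeasure ρ]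

lemma measurePreserving_seqShift :
    MeasurePreserving seqShift (Measure.infinitePi fun _ : ℕ => ρ)
      (Measure.infinitePi fun _ : ℕ => ρ) :=
  ⟨measurable_pi_iff.2 fun n => measurable_pi_apply (n + 1),
    Measure.map_infinitePi_infinitePi_of_inj (P := fun _ : ℕ => ρ) (add_left_injective 1)⟩

lemma iIndep_comap_eval :
    iIndep (fun i : ℕ => MeasurableSpace.comap (fun x : ℕ → α => x i) inferInstance)
      (Measure.infinitePi fun _ : ℕ => ρ) :=
  iIndepFun_infinitePi (P := fun _ : ℕ => ρ) (X := fun _ y => y) fun _ => measurable_id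

lemma comap_eval_le (i : ℕ) :
    MeasurableSpace.comap (fun x : ℕ → α => x i) inferInstance ≤ MeasurableSpace.pi :=
  (measurable_pi_apply i).comap_le

lemma measurable_seqShift_iterate_iSup (m : ℕ) :
    Measurable[⨆ i ∈ Set.Ici m, MeasurableSpace.comap (fun x : ℕ → α => x i) inferInstance]
      (seqShift^[m] : (ℕ → α) → ℕ → α) := by
  refine @measurable_pi_lambda _ _ _ (_) _ _ fun n => ?_
  simp only [seqShift_iterate]
  refine Measurable.mono (comap_measurable fun x : ℕ → α => x (n + m)) ?_ le_rfl
  exact le_iSup₂_of_le (n + m) (by simp) le_rfl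

/-- An event depending on the first `m` coordinates is independent of an event depending on the
later ones. -/
lemma infinitePi_inter_preimage_seqShift {m : ℕ} {A B : Set (ℕ → α)}
    (hA : MeasurableSet[⨆ i ∈ Set.Iio m,
      MeasurableSpace.comap (fun x : ℕ → α => x i) inferInstance] A) (hB : MeasurableSet B) :
    Measure.infinitePi (fun _ : ℕ => ρ) (A ∩ seqShift^[m] ⁻¹' B) =
      Measure.infinitePi (fun _ : ℕ => ρ) A * Measure.infinitePi (fun _ : ℕ => ρ) B := by
  have hind := indep_iSup_of_disjoint comap_eval_le (iIndep_comap_eval ρ)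
    (Set.disjoint_left.2 fun i (h : i ∈ Set.Iio m) (h' : i ∈ Set.Ici m) =>
      (Set.mem_Iio.1 h).not_ge h')
  rw [(Indep_iff _ _ _).1 hind A _ hA (measurable_seqShift_iterate_iSup m hB),
    ((measurePreserving_seqShift ρ).iterate m).measure_preimage hB.nullMeasurableSet]

/-- The shift is ergodic for an infinite product of copies of a probability measure. -/
theorem ergodic_seqShift : Ergodic seqShift (Measure.infinitePi fun _ : ℕ => ρ) := by
  refine ⟨measurePreserving_seqShift ρ, ⟨fun A hA hinv => ?_⟩⟩
  have hit : ∀ m : ℕ, seqShift^[m] ⁻¹' A = A := fun m => by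
    induction m with
    | zero => rfl
    | succ m ih => rw [Function.iterate_succ, Set.preimage_comp, ih, hinv]
  -- Being equal to its preimage under every iterate, `A` depends only on the coordinates from `m`
  -- on, for every `m`, so Kolmogorov's zero-one law applies.
  have htail : MeasurableSet[limsup (fun i : ℕ =>
      MeasurableSpace.comap (fun x : ℕ → α => x i) inferInstance) atTop] A := by
    rw [limsup_eq_iInf_iSup_of_nat]
    refine MeasurableSpace.measurableSet_iInf.2 fun m => ?_
    have := measurable_seqShift_iterate_iSup m hA
    rwa [hit m] at this
  rw [eventuallyConst_set']
  rcases measure_zero_or_one_of_measurableSet_limsup_atTop comap_eval_le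
    (iIndep_comap_eval ρ) htail with h | h
  · exact Or.inl (ae_eq_empty.2 h)
  · exact Or.inr (ae_eq_univ.2 ((prob_compl_eq_zero_iff hA).2 h))

end Shift

/-! ### Visits to the identity and their geometric law -/

section Visits

variable {G : Type*} [Group G]

/-- The product of the first `n` terms of a sequence. -/
def seqProd (x : ℕ → G) : ℕ → G
  | 0 => 1
  | n + 1 => seqProd x n * x n

lemma seqProd_add (x : ℕ → G) (m n : ℕ) :
    seqProd x (m + n) = seqProd x m * seqProd (seqShift^[m] x) n := by
  induction n with
  | zero => simp [seqProd]
  | succ n ih => rw [← add_assoc, seqProd, seqProd, ih, seqShift_iterate, mul_assoc, add_comm n m]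

open Classical in
/-- The number of visits of the partial products to the identity before time `m`. -/
noncomputable def visits (m : ℕ) (x : ℕ → G) : ℕ :=
  ((Finset.range m).filter fun j => seqProd x j = 1).card

/-- The total number of visits of the partial products to the identity; it is `0` by convention if
there are infinitely many of them. -/
noncomputable def totalVisits (x : ℕ → G) : ℕ := ⨆ m, visits m x

lemma visits_mono (x : ℕ → G) : Monotone fun m => visits m x := fun _ _ h => by
  classical
  exact Finset.card_le_card (Finset.filter_subset_filter _ (Finset.range_mono h))

lemma visits_add (m n : ℕ) (x : ℕ → G) (h : seqProd x m = 1) :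
    visits (m + n) x = visits m x + visits n (seqShift^[m] x) := by
  classical
  simp only [visits, Finset.card_filter, Finset.sum_range_add, seqProd_add, h, one_mul]

lemma visits_eq_one {m : ℕ} (hm : 1 ≤ m) (x : ℕ → G)
    (h : ∀ j, 1 ≤ j → j < m → seqProd x j ≠ 1) : visits m x = 1 := by
  classical
  rw [visits, Finset.card_eq_one]
  refine ⟨0, ?_⟩
  ext j
  simp only [Finset.mem_filter, Finset.mem_range, Finset.mem_singleton]
  constructor
  · rintro ⟨hj, h1⟩
    by_contra h0
    exact h j (by omega) hj h1
  · rintro rfl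
    exact ⟨by omega, rfl⟩

lemma visits_one (x : ℕ → G) : visits 1 x = 1 :=
  visits_eq_one le_rfl x fun j h1 h2 => by omega

lemma bddAbove_visits {x : ℕ → G} (h : {n | seqProd x n = 1}.Finite) :
    BddAbove (Set.range fun m => visits m x) := by
  classical
  refine ⟨h.toFinset.card, ?_⟩
  rintro _ ⟨m, rfl⟩
  exact Finset.card_le_card fun j hj => by simpa using (Finset.mem_filter.1 hj).2

lemma visits_le_totalVisits {x : ℕ → G} (h : {n | seqProd x n = 1}.Finite) (m : ℕ) :
    visits m x ≤ totalVisits x :=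
  le_ciSup (bddAbove_visits h) m

lemma exists_visits_eq_totalVisits {x : ℕ → G} (h : {n | seqProd x n = 1}.Finite) :
    ∃ N, ∀ n, N ≤ n → visits n x = totalVisits x := by
  obtain ⟨N, hN⟩ := Nat.sSup_mem (Set.range_nonempty fun m => visits m x) (bddAbove_visits h)
  refine ⟨N, fun n hn => le_antisymm (visits_le_totalVisits h n) ?_⟩
  rw [totalVisits, iSup, ← hN]
  exact visits_mono x hn

/-- The event that the partial products return to the identity for the first time at time `m`. -/
def firstReturn (G : Type*) [Group G] (m : ℕ) : Set (ℕ → G) :=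
  {x | seqProd x m = 1 ∧ ∀ j, 1 ≤ j → j < m → seqProd x j ≠ 1}

lemma pairwise_disjoint_firstReturn :
    Pairwise (Function.onFun Disjoint fun m => firstReturn G (m + 1)) := by
  intro m n hmn
  refine Set.disjoint_left.2 fun x hm hn => ?_
  rcases hmn.lt_or_gt with h | h
  · exact hn.2 (m + 1) (by omega) (by omega) hm.1
  · exact hm.2 (n + 1) (by omega) (by omega) hn.1

lemma exists_mem_firstReturn {x : ℕ → G} {n : ℕ} (hn : 1 ≤ n) (h : seqProd x n = 1) :
    ∃ m, m + 1 ≤ n ∧ x ∈ firstReturn G (m + 1) := by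
  classical
  have hex : ∃ n, 1 ≤ n ∧ seqProd x n = 1 := ⟨n, hn, h⟩
  obtain ⟨h1, h2⟩ := Nat.find_spec hex
  refine ⟨Nat.find hex - 1, ?_, ?_⟩
  · rw [Nat.sub_add_cancel h1]
    exact Nat.find_min' hex ⟨hn, h⟩
  · rw [Nat.sub_add_cancel h1]
    exact ⟨h2, fun j hj hlt hj1 => Nat.find_min hex hlt ⟨hj, hj1⟩⟩

/-- The event that the partial products visit the identity at least `k` times. -/
def visitsGE (G : Type*) [Group G] (k : ℕ) : Set (ℕ → G) := {x | ∃ m, k ≤ visits m x}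

lemma visitsGE_one : visitsGE G 1 = Set.univ :=
  Set.eq_univ_of_forall fun x => ⟨1, (visits_one x).ge⟩

/-- Decomposition at the first return: the visit at time `0` is the only one before it, and the walk
then starts afresh at the identity. -/
lemma visitsGE_succ {k : ℕ} (hk : 1 ≤ k) :
    visitsGE G (k + 1) = ⋃ m, firstReturn G (m + 1) ∩ seqShift^[m + 1] ⁻¹' visitsGE G k := by
  ext x
  simp only [Set.mem_iUnion, Set.mem_inter_iff, Set.mem_preimage]
  constructor
  · rintro ⟨N, hN⟩
    have hN1 : 1 ≤ N := by
      by_contra h0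
      obtain rfl : N = 0 := by omega
      simp [visits] at hN
    obtain ⟨j, hj1, hjN, hj⟩ : ∃ j, 1 ≤ j ∧ j < N ∧ seqProd x j = 1 := by
      by_contra! hno
      have := visits_eq_one hN1 x hno
      omega
    obtain ⟨m, hm, hx⟩ := exists_mem_firstReturn hj1 hj
    refine ⟨m, hx, N - (m + 1), ?_⟩
    have := visits_add (m + 1) (N - (m + 1)) x hx.1
    rw [visits_eq_one (by omega) x hx.2, Nat.add_sub_cancel' (by omega)] at this
    omega
  · rintro ⟨m, hx, N, hN⟩
    refine ⟨m + 1 + N, ?_⟩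
    rw [visits_add (m + 1) N x hx.1, visits_eq_one (by omega) x hx.2]
    omega

lemma mem_visitsGE_iff {x : ℕ → G} (h : {n | seqProd x n = 1}.Finite) (k : ℕ) :
    x ∈ visitsGE G k ↔ k ≤ totalVisits x := by
  constructor
  · rintro ⟨m, hm⟩
    exact hm.trans (visits_le_totalVisits h m)
  · intro hk
    obtain ⟨N, hN⟩ := exists_visits_eq_totalVisits h
    exact ⟨N, by rwa [hN N le_rfl]⟩

variable [Countable G] [MeasurableSpace G] [DiscreteMeasurableSpace G]

/-- The sharp σ-algebra is needed so that a first return at time `m` is independent of the sequence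
shifted by `m`. -/
lemma measurable_seqProd_iSup {n m : ℕ} (h : n ≤ m) :
    Measurable[⨆ i ∈ Set.Iio m, MeasurableSpace.comap (fun x : ℕ → G => x i) inferInstance]
      (fun x : ℕ → G => seqProd x n) := by
  induction n with
  | zero => exact @measurable_const _ _ (_) _ _
  | succ n ih =>
    refine @Measurable.mul _ _ _ _ _ (_) _ _ (ih (by omega)) ?_
    refine Measurable.mono (comap_measurable fun x : ℕ → G => x n) ?_ le_rfl
    exact le_iSup₂_of_le n (by simpa using h) le_rfl

lemma measurable_seqProd (n : ℕ) : Measurable (fun x : ℕ → G => seqProd x n) :=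
  (measurable_seqProd_iSup le_rfl).mono (iSup₂_le fun i _ => comap_eval_le i) le_rfl

lemma measurable_visits (m : ℕ) : Measurable (visits m : (ℕ → G) → ℕ) := by
  classical
  simp only [funext fun x : ℕ → G => show visits m x = _ from Finset.card_filter _ _]
  exact Finset.measurable_sum _ fun j _ => Measurable.ite
    (measurable_seqProd j (measurableSet_singleton 1)) measurable_const measurable_const

lemma measurable_totalVisits : Measurable (totalVisits : (ℕ → G) → ℕ) :=
  Measurable.iSup measurable_visits

lemma measurableSet_firstReturn (m : ℕ) :
    MeasurableSet[⨆ i ∈ Set.Iio m, MeasurableSpace.comap (fun x : ℕ → G => x i) inferInstance]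
      (firstReturn G m) := by
  have : firstReturn G m = (fun x => seqProd x m) ⁻¹' {1} ∩
      ⋂ j ∈ Set.Ico 1 m, (fun x => seqProd x j) ⁻¹' {1}ᶜ := by
    ext x
    simp [firstReturn]
  rw [this]
  refine MeasurableSet.inter (measurable_seqProd_iSup le_rfl (measurableSet_singleton 1)) ?_
  exact MeasurableSet.biInter (Set.to_countable _) fun j hj =>
    measurable_seqProd_iSup hj.2.le (measurableSet_singleton 1).compl

lemma measurableSet_visitsGE (k : ℕ) : MeasurableSet (visitsGE G k) := by
  have : visitsGE G k = ⋃ m, visits m ⁻¹' Set.Ici k := by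
    ext x
    simp [visitsGE]
  rw [this]
  exact .iUnion fun m => measurable_visits m measurableSet_Ici

variable (ρ : Measure G) [IsProbabilityMeasure ρ]

/-- The number of visits to the identity is geometric. -/
theorem infinitePi_visitsGE (k : ℕ) :
    Measure.infinitePi (fun _ : ℕ => ρ) (visitsGE G (k + 1)) =
      Measure.infinitePi (fun _ : ℕ => ρ) {x | ∃ n, 1 ≤ n ∧ seqProd x n = 1} ^ k := by
  have hret : ∀ m, MeasurableSet (firstReturn G m) := fun m =>
    (iSup₂_le fun i _ => comap_eval_le i : (⨆ i ∈ Set.Iio m,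
      MeasurableSpace.comap (fun x : ℕ → G => x i) inferInstance) ≤ _) _
        (measurableSet_firstReturn m)
  have hunion : {x : ℕ → G | ∃ n, 1 ≤ n ∧ seqProd x n = 1} = ⋃ m, firstReturn G (m + 1) := by
    ext x
    simp only [Set.mem_ofPred_eq, Set.mem_iUnion]
    constructor
    · rintro ⟨n, hn, h⟩
      obtain ⟨m, -, hm⟩ := exists_mem_firstReturn hn h
      exact ⟨m, hm⟩
    · rintro ⟨m, hm⟩
      exact ⟨m + 1, by omega, hm.1⟩
  induction k with
  | zero => simp [visitsGE_one]
  | succ k ih =>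
    rw [visitsGE_succ (by omega), measure_iUnion
      (fun m n hmn => (pairwise_disjoint_firstReturn hmn).mono
        Set.inter_subset_left Set.inter_subset_left)
      (fun m => (hret _).inter (((measurePreserving_seqShift ρ).measurable.iterate _)
        (measurableSet_visitsGE _)))]
    -- Each summand factors by independence; the first-return probabilities then add up to the
    -- return probability.
    simp only [infinitePi_inter_preimage_seqShift ρ (measurableSet_firstReturn _)
      (measurableSet_visitsGE _)]
    rw [ENNReal.tsum_mul_right, ih, ← measure_iUnion pairwise_disjoint_firstReturn
      fun m => hret _, ← hunion, pow_succ, mul_comm]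

end Visits

/-! ### Summation by parts for power series -/

section Series

lemma summable_mul_pow_of_summable_succ {a : ℕ → ℝ} {q : ℝ} (hq : 0 ≤ q)
    (h : Summable fun j => |a (j + 1)| * q ^ (j + 1)) : Summable fun j => a (j + 1) * q ^ j := by
  rcases hq.eq_or_lt with rfl | hq
  · refine summable_of_ne_finset_zero (s := {0}) fun j hj => ?_
    rw [zero_pow (by simpa using hj), mul_zero]
  · refine Summable.of_norm ((h.mul_right q⁻¹).congr fun j => ?_)
    rw [norm_mul, Real.norm_eq_abs, Real.norm_eq_abs, abs_of_nonneg (pow_nonneg hq.le j), pow_succ]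
    field_simp

lemma summable_mul_pow_of_succ {a : ℕ → ℝ} {q : ℝ}
    (h : Summable fun j => a (j + 1) * q ^ j) : Summable fun j => a j * q ^ j := by
  rw [← summable_nat_add_iff 1]
  exact (h.mul_right q).congr fun j => by ring

lemma summable_sub_mul_pow {a : ℕ → ℝ} {q : ℝ}
    (h : Summable fun j => a (j + 1) * q ^ j) : Summable fun j => (a (j + 1) - a j) * q ^ j :=
  (h.sub (summable_mul_pow_of_succ h)).congr fun j => by ring

/-- Used for `f` and again for `g`; each use produces one factor `1 - q`, the escape probability. -/
lemma tsum_sub_mul_pow {a : ℕ → ℝ} {q : ℝ} (h0 : a 0 = 0)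
    (h : Summable fun j => a (j + 1) * q ^ j) :
    ∑' j, (a (j + 1) - a j) * q ^ j = (1 - q) * ∑' j, a (j + 1) * q ^ j := by
  have h1 : ∑' j, a j * q ^ j = (∑' j, a (j + 1) * q ^ j) * q := by
    rw [(summable_mul_pow_of_succ h).tsum_eq_zero_add, h0, zero_mul, zero_add, ← tsum_mul_right]
    exact tsum_congr fun j => by ring
  simp only [sub_mul]
  rw [h.tsum_sub (summable_mul_pow_of_succ h), h1]
  ring

end Series

/-! ### Local times as sums over starting times -/

section LocalTime

-- Telescoping over the indices satisfying `p`, by peeling off the index `0`. When `p i` holds, `j =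
-- 0` is counted, so the natural subtraction of `1` is not truncated.
open Classical in
lemma sum_increments_eq (f : ℕ → ℝ) (n : ℕ) (p : ℕ → Prop) :
    ∑ i ∈ Finset.range n, (if p i then
      f ((Finset.range (n - i)).filter fun j => p (i + j)).card -
        f (((Finset.range (n - i)).filter fun j => p (i + j)).card - 1) else 0) =
      f ((Finset.range n).filter p).card - f 0 := by
  induction n generalizing p with
  | zero => simp
  | succ n ih =>
    have hcard : ((Finset.range (n + 1)).filter p).card =
        ((Finset.range n).filter fun j => p (j + 1)).card + if p 0 then 1 else 0 := by
      simp only [Finset.card_filter, Finset.sum_range_succ']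
    have := ih fun i => p (i + 1)
    have hassoc : ∀ i j, i + j + 1 = i + 1 + j := fun i j => by omega
    simp only [hassoc] at this
    rw [Finset.sum_range_succ']
    simp only [Nat.add_sub_add_right, this, zero_add, Nat.sub_zero, hcard]
    split_ifs <;> simp

/-- The sequence of increments of a walk. -/
def increments {Ω G : Type*} [Group G] (S : ℕ → Ω → G) (ω : Ω) : ℕ → G :=
  fun n => (S n ω)⁻¹ * S (n + 1) ω

variable {Ω G : Type*} [Group G]

lemma mul_seqProd_increments (S : ℕ → Ω → G) (ω : Ω) (i j : ℕ) :
    S i ω * seqProd (seqShift^[i] (increments S ω)) j = S (i + j) ω := by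
  induction j with
  | zero => simp [seqProd]
  | succ j ih =>
    rw [seqProd, ← mul_assoc, ih, seqShift_iterate, increments, add_comm j i, mul_inv_cancel_left,
      add_assoc]

/-- Only coincidences between positions matter, so the value of `S 0` plays no role and the
representation of `localTimeSum` holds at every `ω`. -/
lemma seqProd_increments_eq_one_iff (S : ℕ → Ω → G) (ω : Ω) (i j : ℕ) :
    seqProd (seqShift^[i] (increments S ω)) j = 1 ↔ S (i + j) ω = S i ω := by
  rw [← mul_seqProd_increments S ω i j, mul_eq_left]

lemma localTimeSum_eq_sum_visits (S : ℕ → Ω → G) {f : ℕ → ℝ} (hf0 : f 0 = 0) {n : ℕ} (hn : 1 ≤ n)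
    (ω : Ω) : localTimeSum S f n ω = ∑ i ∈ Finset.range n,
      (f (visits (n - i) (seqShift^[i] (increments S ω))) -
        f (visits (n - i) (seqShift^[i] (increments S ω)) - 1)) := by
  classical
  set g : ℕ → ℝ := fun i => f (visits (n - i) (seqShift^[i] (increments S ω))) -
        f (visits (n - i) (seqShift^[i] (increments S ω)) - 1) with hg
  have hloc : ∀ x, f (localTime S (n - 1) x ω) =
      ∑ i ∈ Finset.range n, if S i ω = x then g i else 0 := by
    intro x
    have h := sum_increments_eq f n fun i => S i ω = x
    rw [hf0, sub_zero] at h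
    rw [localTime, Nat.sub_add_cancel hn]
    convert h.symm using 1
    refine Finset.sum_congr rfl fun i _ => ?_
    split_ifs with hi
    · subst hi
      simp only [hg, visits, seqProd_increments_eq_one_iff]
    · rfl
  rw [localTimeSum, tsum_eq_sum (s := (Finset.range n).image fun i => S i ω)]
  · simp only [hloc]
    rw [Finset.sum_comm]
    refine Finset.sum_congr rfl fun i hi => ?_
    rw [Finset.sum_ite_eq, if_pos (Finset.mem_image_of_mem _ hi)]
  · intro x hx
    rw [hloc]
    refine Finset.sum_eq_zero fun i hi => if_neg ?_
    rintro rfl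
    exact hx (Finset.mem_image_of_mem _ hi)

end LocalTime

/-! ### Expectations of functions of the total number of visits -/

section Geometric

variable {G : Type*} [Group G] [Countable G] [MeasurableSpace G] [DiscreteMeasurableSpace G]
  (ρ : Measure G) [IsProbabilityMeasure ρ]

/-- The probability that the partial products return to the identity. -/
noncomputable def returnProb : ℝ :=
  (Measure.infinitePi fun _ : ℕ => ρ).real {x | ∃ n, 1 ≤ n ∧ seqProd x n = 1}

lemma measureReal_visitsGE (k : ℕ) :
    (Measure.infinitePi fun _ : ℕ => ρ).real (visitsGE G (k + 1)) = returnProb ρ ^ k := by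
  rw [Measure.real, infinitePi_visitsGE, ENNReal.toReal_pow, returnProb, Measure.real]

omit [Countable G] [DiscreteMeasurableSpace G] [IsProbabilityMeasure ρ] in
lemma returnProb_nonneg : 0 ≤ returnProb ρ := measureReal_nonneg

variable {ρ}

/-- Finitely many visits force a return probability less than one. -/
lemma returnProb_lt_one
    (hfin : ∀ᵐ x ∂Measure.infinitePi fun _ : ℕ => ρ, {n | seqProd x n = 1}.Finite) :
    returnProb ρ < 1 := by
  refine lt_of_le_of_ne measureReal_le_one fun h1 => ?_
  -- With return probability one, every level of visits is reached almost surely, against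
  -- finiteness.
  have hall : ∀ᵐ x ∂Measure.infinitePi fun _ : ℕ => ρ, ∀ k, x ∈ visitsGE G (k + 1) := by
    refine ae_all_iff.2 fun k => (prob_compl_eq_zero_iff (measurableSet_visitsGE _)).2 ?_
    have := measureReal_visitsGE ρ k
    rw [h1, one_pow] at this
    rw [← ENNReal.ofReal_toReal (measure_ne_top (Measure.infinitePi fun _ : ℕ => ρ)
      (visitsGE G (k + 1))), ← Measure.real, this, ENNReal.ofReal_one]
  obtain ⟨x, hx, hxfin⟩ := (hall.and hfin).exists
  have := (mem_visitsGE_iff hxfin _).1 (hx (totalVisits x))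
  omega

omit [Countable G] [MeasurableSpace G] [DiscreteMeasurableSpace G] in
lemma tsum_indicator_visitsGE {x : ℕ → G} (hx : {n | seqProd x n = 1}.Finite) (h : ℕ → ℝ) :
    ∑' k, (visitsGE G (k + 1)).indicator (fun _ => h k) x =
      ∑ k ∈ Finset.range (totalVisits x), h k := by
  rw [tsum_eq_sum (s := Finset.range (totalVisits x))]
  · refine Finset.sum_congr rfl fun k hk => Set.indicator_of_mem ?_ _
    exact (mem_visitsGE_iff hx _).2 (Finset.mem_range.1 hk)
  · intro k hk
    refine Set.indicator_of_notMem (fun hmem => hk ?_) _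
    exact Finset.mem_range.2 ((mem_visitsGE_iff hx _).1 hmem)

/-- The sum is `∑ h k` over the events `visitsGE G (k + 1)`, of probability `q ^ k`; absolute
summability permits the interchange with the integral. -/
lemma integral_sum_range_totalVisits
    (hfin : ∀ᵐ x ∂Measure.infinitePi fun _ : ℕ => ρ, {n | seqProd x n = 1}.Finite) {h : ℕ → ℝ}
    (hh : Summable fun k => h k * returnProb ρ ^ k) :
    Integrable (fun x => ∑ k ∈ Finset.range (totalVisits x), h k)
        (Measure.infinitePi fun _ : ℕ => ρ) ∧
      ∫ x, ∑ k ∈ Finset.range (totalVisits x), h k ∂(Measure.infinitePi fun _ : ℕ => ρ) =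
        ∑' k, h k * returnProb ρ ^ k := by
  set ν := Measure.infinitePi fun _ : ℕ => ρ with hν
  have hint : ∀ k, ∀ c : ℝ, ∫ x, (visitsGE G (k + 1)).indicator (fun _ => c) x ∂ν =
      c * returnProb ρ ^ k := fun k c => by
    rw [integral_indicator_const _ (measurableSet_visitsGE _), measureReal_visitsGE, smul_eq_mul,
      mul_comm]
  have hi : ∀ k, ∀ c : ℝ, Integrable ((visitsGE G (k + 1)).indicator fun _ => c) ν := fun k c =>
    (integrable_const c).indicator (measurableSet_visitsGE _)
  have hnorm : ∀ k, ∀ x, ‖(visitsGE G (k + 1)).indicator (fun _ => h k) x‖ =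
      (visitsGE G (k + 1)).indicator (fun _ => |h k|) x := fun k x => by
    rw [norm_indicator_eq_indicator_norm]
    rfl
  have hsum : Summable fun k => ∫ x, ‖(visitsGE G (k + 1)).indicator (fun _ => h k) x‖ ∂ν := by
    simp only [hnorm, hint]
    refine hh.norm.congr fun k => ?_
    rw [norm_mul, Real.norm_eq_abs, norm_pow, Real.norm_of_nonneg (returnProb_nonneg ρ)]
  constructor
  · refine ⟨(measurable_from_nat (f := fun v => ∑ k ∈ Finset.range v, h k) |>.comp
      measurable_totalVisits).aestronglyMeasurable, ?_⟩
    have hle : ∫⁻ x, ‖∑ k ∈ Finset.range (totalVisits x), h k‖ₑ ∂ν ≤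
        ∫⁻ x, ∑' k, ‖(visitsGE G (k + 1)).indicator (fun _ => h k) x‖ₑ ∂ν := by
      refine lintegral_mono_ae ?_
      filter_upwards [hfin] with x hx
      refine (enorm_sum_le _ _).trans ?_
      refine le_trans (Finset.sum_le_sum fun k hk => ?_) (ENNReal.sum_le_tsum _)
      rw [Set.indicator_of_mem ((mem_visitsGE_iff hx _).2 (Finset.mem_range.1 hk))]
    refine hle.trans_lt ?_
    rw [lintegral_tsum fun k => (hi k (h k)).1.enorm]
    simp only [← ofReal_integral_norm_eq_lintegral_enorm (hi _ (h _))]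
    rw [← ENNReal.ofReal_tsum_of_nonneg (fun k => integral_nonneg fun x => norm_nonneg _) hsum]
    exact ENNReal.ofReal_lt_top
  · have := integral_tsum_of_summable_integral_norm (fun k => hi k (h k)) hsum
    simp only [hint] at this
    rw [this]
    refine integral_congr_ae ?_
    filter_upwards [hfin] with x hx
    exact (tsum_indicator_visitsGE hx h).symm

end Geometric

/-! ### Transfer from the walk to the product space -/

section RandomWalk

variable {Ω G : Type*} [MeasurableSpace Ω] [Group G] [Countable G] [MeasurableSpace G]
  [DiscreteMeasurableSpace G] {μ : Measure Ω} [IsProbabilityMeasure μ] {S : ℕ → Ω → G}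

omit [IsProbabilityMeasure μ] in
lemma IsRandomWalk.measurable_increment (hS : IsRandomWalk S μ) (n : ℕ) :
    Measurable fun ω => (S n ω)⁻¹ * S (n + 1) ω :=
  (hS.measurable n).inv.mul (hS.measurable (n + 1))

omit [IsProbabilityMeasure μ] in
lemma IsRandomWalk.measurePreserving_increments (hS : IsRandomWalk S μ) :
    MeasurePreserving (increments S) μ
      (Measure.infinitePi fun _ : ℕ => μ.map fun ω => (S 0 ω)⁻¹ * S 1 ω) := by
  refine ⟨measurable_pi_iff.2 hS.measurable_increment, ?_⟩
  refine (hS.indep.map_fun_eq_infinitePi_map hS.measurable_increment).trans ?_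
  congr 1
  exact funext fun n => (hS.identDistrib n).map_eq

omit [Countable G] [DiscreteMeasurableSpace G] [IsProbabilityMeasure μ] in
lemma IsRandomWalk.ae_seqProd_increments_eq_one_iff (hS : IsRandomWalk S μ) :
    ∀ᵐ ω ∂μ, ∀ n, seqProd (increments S ω) n = 1 ↔ S n ω = 1 := by
  filter_upwards [hS.start] with ω hω n
  have := seqProd_increments_eq_one_iff S ω 0 n
  rwa [zero_add, hω] at this

lemma measurableSet_finite_seqProd :
    MeasurableSet {x : ℕ → G | {n | seqProd x n = 1}.Finite} := by
  have : {x : ℕ → G | {n | seqProd x n = 1}.Finite} =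
      ⋃ N, ⋂ n, ⋂ (_ : N < n), (fun x => seqProd x n) ⁻¹' {1}ᶜ := by
    ext x
    simp only [Set.mem_ofPred_eq, Set.mem_iUnion, Set.mem_iInter, Set.mem_preimage,
      Set.mem_compl_iff, Set.mem_singleton_iff]
    rw [Set.finite_iff_bddAbove]
    refine exists_congr fun N => ⟨fun h n hn h1 => (h h1).not_gt hn, fun h n h1 => ?_⟩
    by_contra! hn
    exact h n hn h1
  rw [this]
  exact .iUnion fun N => .iInter fun n => .iInter fun _ =>
    measurable_seqProd n (measurableSet_singleton 1).compl

omit [IsProbabilityMeasure μ] in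
lemma IsRandomWalk.ae_finite_seqProd (hS : IsRandomWalk S μ) (htrans : IsTransient S μ) :
    ∀ᵐ x ∂Measure.infinitePi fun _ : ℕ => μ.map fun ω => (S 0 ω)⁻¹ * S 1 ω,
      {n | seqProd x n = 1}.Finite := by
  have hξ := hS.measurePreserving_increments
  rw [← hξ.map_eq, ae_map_iff hξ.aemeasurable measurableSet_finite_seqProd]
  filter_upwards [htrans, hS.ae_seqProd_increments_eq_one_iff] with ω hω hiff
  simpa only [hiff] using hω

lemma IsRandomWalk.escapeProb_eq (hS : IsRandomWalk S μ) :
    escapeProb S μ = 1 - returnProb (μ.map fun ω => (S 0 ω)⁻¹ * S 1 ω) := by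
  have hξ := hS.measurePreserving_increments
  have hm : MeasurableSet {x : ℕ → G | ∃ n, 1 ≤ n ∧ seqProd x n = 1} := by
    have : {x : ℕ → G | ∃ n, 1 ≤ n ∧ seqProd x n = 1} =
        ⋃ n, ⋃ (_ : 1 ≤ n), (fun x => seqProd x n) ⁻¹' {1} := by
      ext x
      simp
    rw [this]
    exact .iUnion fun n => .iUnion fun _ => measurable_seqProd n (measurableSet_singleton 1)
  rw [returnProb, ← hξ.measureReal_preimage hm.nullMeasurableSet,
    ← probReal_compl_eq_one_sub (hξ.measurable hm), escapeProb]
  refine measureReal_congr ?_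
  filter_upwards [hS.ae_seqProd_increments_eq_one_iff] with ω hω
  refine propext ?_
  change (∀ n, 1 ≤ n → S n ω ≠ 1) ↔ ¬ ∃ n, 1 ≤ n ∧ seqProd (increments S ω) n = 1
  simp only [hω, not_exists, not_and, ne_eq]

end RandomWalk

/-! ### The main theorem -/

theorem theorem1 {Ω G : Type*} [MeasurableSpace Ω] [Group G] [Countable G] [MeasurableSpace G]
    [DiscreteMeasurableSpace G] (μ : Measure Ω) [IsProbabilityMeasure μ]
    (S : ℕ → Ω → G) (hS : IsRandomWalk S μ) (htrans : IsTransient S μ)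
    (f : ℕ → ℝ) (hf0 : f 0 = 0)
    (hf : Summable (fun j : ℕ => |f (j + 1)| * (1 - escapeProb S μ) ^ (j + 1))) :
    0 < escapeProb S μ ∧
    Summable (fun j : ℕ => f (j + 1) * (1 - escapeProb S μ) ^ j) ∧
    (∀ᵐ ω ∂μ, Tendsto (fun n : ℕ => localTimeSum S f n ω / n) atTop
      (𝓝 (escapeProb S μ ^ 2 * ∑' j : ℕ, f (j + 1) * (1 - escapeProb S μ) ^ j))) ∧
    (∀ n : ℕ, 1 ≤ n → Integrable (localTimeSum S f n) μ) ∧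
    Tendsto (fun n : ℕ => eLpNorm (fun ω => localTimeSum S f n ω / n -
      escapeProb S μ ^ 2 * ∑' j : ℕ, f (j + 1) * (1 - escapeProb S μ) ^ j) 1 μ) atTop (𝓝 0) := by
  have hξ := hS.measurePreserving_increments
  have hfin := hS.ae_finite_seqProd htrans
  have hesc := hS.escapeProb_eq
  set ρ := μ.map fun ω => (S 0 ω)⁻¹ * S 1 ω with hρ
  have : IsProbabilityMeasure ρ :=
    Measure.isProbabilityMeasure_map (hS.measurable_increment 0).aemeasurable
  set ν := Measure.infinitePi fun _ : ℕ => ρ with hν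
  set q := returnProb ρ with hq
  have hq0 : 0 ≤ q := returnProb_nonneg ρ
  have hq1 : 1 - escapeProb S μ = q := by rw [hesc]; ring
  simp only [hq1] at hf ⊢
  have hfs : Summable fun j => f (j + 1) * q ^ j := summable_mul_pow_of_summable_succ hq0 hf
  set g : ℕ → ℝ := fun v => f v - f (v - 1) with hg
  have hg0 : g 0 = 0 := by simp [hg]
  have hgs : Summable fun j => g (j + 1) * q ^ j := summable_sub_mul_pow hfs
  have hgabs : Summable fun j => |g (j + 1)| * q ^ j := hgs.norm.congr fun j => by
    rw [norm_mul, Real.norm_eq_abs, norm_pow, Real.norm_of_nonneg hq0]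
  have hgsum : ∀ v, ∑ k ∈ Finset.range v, (g (k + 1) - g k) = g v := fun v => by
    rw [Finset.sum_range_sub, hg0, sub_zero]
  -- Summing absolute values, rather than taking `|g (totalVisits x)|`, dominates `g` at all smaller
  -- visit counts too.
  set H : (ℕ → G) → ℝ := fun x => ∑ k ∈ Finset.range (totalVisits x), |g (k + 1)| with hH
  have hHi : Integrable H ν := (integral_sum_range_totalVisits hfin hgabs).1
  have hHm : Measurable H := measurable_from_nat (f := fun v => ∑ k ∈ Finset.range v, |g (k + 1)|)
    |>.comp measurable_totalVisits
  have hbound : ∀ {v w : ℕ}, v ≤ w → |g v| ≤ ∑ k ∈ Finset.range w, |g (k + 1)| := by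
    intro v w hvw
    rcases v with _ | v
    · rw [hg0, abs_zero]
      exact Finset.sum_nonneg fun _ _ => abs_nonneg _
    · exact Finset.single_le_sum (f := fun k => |g (k + 1)|) (fun _ _ => abs_nonneg _)
        (Finset.mem_range.2 hvw)
  have hφm : Measurable fun x : ℕ → G => g (totalVisits x) :=
    measurable_from_nat (f := g) |>.comp measurable_totalVisits
  have ham : ∀ n, Measurable fun x : ℕ → G => g (visits n x) := fun n =>
    measurable_from_nat (f := g) |>.comp (measurable_visits n)
  have hφH : ∀ᵐ x ∂ν, |g (totalVisits x)| ≤ H x := .of_forall fun x => hbound le_rfl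
  have haH : ∀ᵐ x ∂ν, ∀ n, |g (visits n x)| ≤ H x :=
    hfin.mono fun x hx n => hbound (visits_le_totalVisits hx n)
  have hconv : ∀ᵐ x ∂ν, ∃ N, ∀ n, N ≤ n → g (visits n x) = g (totalVisits x) :=
    hfin.mono fun x hx => (exists_visits_eq_totalVisits hx).imp fun N hN n hn => by rw [hN n hn]
  -- `g(V)` is the sum of its own increments below `V`; summation by parts for `g` and then for `f`
  -- gives the square.
  have hmean : ∫ x, g (totalVisits x) ∂ν = escapeProb S μ ^ 2 * ∑' j, f (j + 1) * q ^ j := by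
    have h := (integral_sum_range_totalVisits hfin (summable_sub_mul_pow hgs)).2
    simp only [hgsum] at h
    rw [h, tsum_sub_mul_pow hg0 hgs]
    have h' := tsum_sub_mul_pow hf0 hfs
    simp only [hg, Nat.add_sub_cancel]
    rw [h', hesc]
    ring
  have herg : Ergodic seqShift ν := ergodic_seqShift ρ
  have hrep : ∀ n, 1 ≤ n → ∀ ω, localTimeSum S f n ω =
      ∑ i ∈ Finset.range n, g (visits (n - i) (seqShift^[i] (increments S ω))) :=
    fun n hn ω => localTimeSum_eq_sum_visits S hf0 hn ω
  have hsi := integrable_sum_approx herg.toMeasurePreserving ham hHi haH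
  refine ⟨?_, hfs, ?_, fun n hn => ?_, ?_⟩
  · rw [hesc]
    linarith [returnProb_lt_one hfin]
  · filter_upwards [hξ.quasiMeasurePreserving.ae
      (herg.ae_tendsto_sum_approx_div hφm ham hHm hHi hφH haH hconv)] with ω hω
    rw [hmean] at hω
    refine hω.congr' ?_
    filter_upwards [eventually_ge_atTop 1] with n hn
    rw [hrep n hn]
  · rw [funext (hrep n hn)]
    exact hξ.integrable_comp_of_integrable (hsi n)
  · have hL := herg.tendsto_eLpNorm_sum_approx_div hφm ham hHm hHi hφH haH hconv
    rw [hmean] at hL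
    refine hL.congr' ?_
    filter_upwards [eventually_ge_atTop 1] with n hn
    simp only [hrep n hn]
    exact (eLpNorm_comp_measurePreserving
      (((hsi n).div_const _).sub (integrable_const _)).aestronglyMeasurable hξ).symm
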